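/- Theorem 3 (Information vs. Randomness of Error). Let $\{|0\rangle,|1\rangle\}$ and $\{|\overline 0\rangle,|\overline 1\rangle\}$ be two orthonormal bases of $\mathbb C^2$ that are mutually unbiased, i.e. $|\langle i|\overline j\rangle|^2=\tfrac12$ for all $i,j\in\{0,1\}$. For $i=i_1\cdots i_N\in\{0,1\}^N$ put $|i\rangle=|i_1\rangle\otimes\cdots\otimes|i_N\rangle$ and $|\overline i\rangle=|\overline{i_1}\rangle\otimes\cdots\otimes|\overline{i_N}\rangle$ in $\mathcal H_B=(\mathbb C^2)^{\otimes N}$. Alice draws $A\in\{0,1\}^N$ uniformly at random and sends to Bob either (a) the state $|A\rangle$ or (b) the state $|\overline A\rangle$; in both cases the average state is the maximally mixed state $\mathbf 1/2^N$. An attack by Eve is a triple $(\mathcal H_E,|\Omega\rangle,U)$ consisting of a finite-dimensional Hilbert space $\mathcal H_E$, a unit vector $|\Omega\rangle\in\mathcal H_E$ and a unitary operator $U$ on $\mathcal H_B\otimes\mathcal H_E$. If Alice sends $|\psi\rangle$, the state of Bob's and Eve's systems after the attack is $U(|\psi\rangle\otimes|\Omega\rangle)$. Eve's optimal information $I(A:E|a)$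 is the supremum, over all POVMs $Z=\{Z_z\}$ on $\mathcal H_E$ with finitely many outcomes, of the mutual information $I(A:Z)$ between $A$ and the outcome of $Z$ when Alice has used method (a). When Alice has used method (b), Bob measures $\mathcal H_B$ in the basis $\{|\overline j\rangle\}_{j\in\{0,1\}^N}$ and obtains $B$; $H(A\oplus B|b)$ denotes the Shannon entropy of the error $A\oplus B$ (bitwise exclusive or) in this case. Entropy and mutual information are measured in bits. Then for every attack $(\mathcal H_E,|\Omega\rangle,U)$ $$I(A:E|a)\;\le\; H(A\oplus B|b).$$ -/

import Mathlib

open scoped TensorProduct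

noncomputable section

namespace InfoDisturbance

/-! ### Classical information quantities, in bits -/

/-- Shannon entropy (base `2`) of a distribution on a finite set; the junk value
`Real.logb 2 0 = 0` realises the convention `0 log 0 = 0`. -/
def shannonEntropy {α : Type*} [Fintype α] (p : α → ℝ) : ℝ :=
  -∑ x, p x * Real.logb 2 (p x)

/-- Mutual information `I(X:Y) = H(X) + H(Y) - H(X,Y)` of a joint distribution. -/
def mutualInfo {α β : Type*} [Fintype α] [Fintype β] (p : α × β → ℝ) : ℝ :=
  shannonEntropy (fun x => ∑ y, p (x, y)) + shannonEntropy (fun y => ∑ x, p (x, y))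
    - shannonEntropy p

/-! ### Qubits and product bases -/

/-- Bit strings of length `N`; addition is the bitwise exclusive or. -/
abbrev BitString (N : ℕ) : Type := Fin N → ZMod 2

/-- The Hilbert space `ℂ²` of one qubit. -/
abbrev Qubit : Type := EuclideanSpace ℂ (Fin 2)

/-- The Hilbert space `ℂ² ⊗ ⋯ ⊗ ℂ²` of `N` qubits, in coordinates with respect to the
product of the standard bases. -/
abbrev Qubits (N : ℕ) : Type := EuclideanSpace ℂ (Fin N → Fin 2)

/-- A pair of orthogonal (normalized) states `|0⟩, |1⟩` of one qubit. -/
abbrev QubitBasis : Type := OrthonormalBasis (ZMod 2) ℂ Qubit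

/-- The two bases are mutually unbiased: `|⟨i|j̄⟩|² = 1/2` for all `i, j`. -/
def MutuallyUnbiased (e f : QubitBasis) : Prop :=
  ∀ i j : ZMod 2, ‖inner ℂ (e i) (f j)‖ ^ 2 = 1 / 2

/-- The product vector `|i⟩ = |i₁⟩ ⊗ ⋯ ⊗ |i_N⟩`. -/
def productVector {N : ℕ} (e : QubitBasis) (i : BitString N) : Qubits N :=
  WithLp.toLp 2 (fun s => ∏ k, e (i k) (s k))

/-- The rank-one operator `|v⟩⟨v|`. -/
def ketbra {H : Type*} [NormedAddCommGroup H] [InnerProductSpace ℂ H] (v : H) : H →ₗ[ℂ] H :=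
  (InnerProductSpace.rankOne ℂ v v : H →L[ℂ] H)

/-! ### Measurements -/

/-- A POVM with finite outcome set `α`. -/
structure POVM (H : Type*) [NormedAddCommGroup H] [InnerProductSpace ℂ H]
    (α : Type*) [Fintype α] where
  /-- The operator attached to an outcome. -/
  effect : α → (H →ₗ[ℂ] H)
  effect_pos : ∀ a, (effect a).IsPositive
  sum_effect : ∑ a, effect a = LinearMap.id

/-- The Born probability `tr(|ψ⟩⟨ψ| M) = ⟨ψ|M|ψ⟩` of the effect `M` in the vector state `ψ`. -/
def bornProb {H : Type*} [NormedAddCommGroup H] [InnerProductSpace ℂ H]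
    (ψ : H) (M : H →ₗ[ℂ] H) : ℝ :=
  (inner ℂ ψ (M ψ)).re

/-! ### The attack -/

/-- An attack by Eve on a transmitted system `HB` with apparatus `HE`: the initial vector state
`|Ω⟩` of the apparatus, and the unitary interaction `U` between the transmitted system and the
apparatus. -/
structure Attack (HB HE : Type*) [NormedAddCommGroup HB] [InnerProductSpace ℂ HB]
    [NormedAddCommGroup HE] [InnerProductSpace ℂ HE] where
  /-- The initial state `|Ω⟩` of the apparatus. -/
  Ω : HE
  norm_Ω : ‖Ω‖ = 1
  /-- The unitary operator describing the interaction. -/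
  U : (HB ⊗[ℂ] HE) ≃ₗᵢ[ℂ] (HB ⊗[ℂ] HE)

section

variable {HB HE : Type*} [NormedAddCommGroup HB] [InnerProductSpace ℂ HB]
  [NormedAddCommGroup HE] [InnerProductSpace ℂ HE]

/-- The state `U (|v⟩ ⊗ |Ω⟩)` of Bob's and Eve's systems after the attack, when Alice has sent
the vector state `|v⟩`. -/
def Attack.finalState (𝒜 : Attack HB HE) (v : HB) : HB ⊗[ℂ] HE :=
  𝒜.U (v ⊗ₜ[ℂ] 𝒜.Ω)

/-- Probability of the effect `M` for a measurement on Bob's system alone (the operator `M ⊗ 1`),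
when Alice has sent `|v⟩`. -/
def Attack.bobProb (𝒜 : Attack HB HE) (v : HB) (M : HB →ₗ[ℂ] HB) : ℝ :=
  bornProb (𝒜.finalState v) (TensorProduct.map M (LinearMap.id : HE →ₗ[ℂ] HE))

/-- Probability of the effect `M` for a measurement on Eve's apparatus alone (the operator
`1 ⊗ M`), when Alice has sent `|v⟩`. -/
def Attack.eveProb (𝒜 : Attack HB HE) (v : HB) (M : HE →ₗ[ℂ] HE) : ℝ :=
  bornProb (𝒜.finalState v) (TensorProduct.map (LinearMap.id : HB →ₗ[ℂ] HB) M)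

end

/-! ### The protocol with `N` qubits -/

section

variable {N : ℕ} {HE : Type*} [NormedAddCommGroup HE] [InnerProductSpace ℂ HE]

/-- Joint distribution of Alice's uniformly random string `A`, encoded in the product basis of
`e`, and the outcome of the POVM `Z` on Eve's apparatus. -/
def Attack.aliceEveDist (𝒜 : Attack (Qubits N) HE) (e : QubitBasis) {α : Type*} [Fintype α]
    (Z : POVM HE α) : BitString N × α → ℝ :=
  fun x => (1 / 2 ^ N) * 𝒜.eveProb (productVector e x.1) (Z.effect x.2)

/-- Eve's optimal information on `A` when Alice encodes `A` in the product basis of `e`: the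
supremum of `I(A:Z)` over all POVMs `Z` with finitely many outcomes on Eve's apparatus, taken in
the extended reals. -/
def Attack.eveInfo (𝒜 : Attack (Qubits N) HE) (e : QubitBasis) : EReal :=
  ⨆ (n : ℕ) (Z : POVM HE (Fin n)), ((mutualInfo (𝒜.aliceEveDist e Z) : ℝ) : EReal)

/-- Joint distribution of Alice's uniformly random string `A`, encoded in the product basis of
`e`, and the outcome `B` of Bob's measurement of the received qubits in the same basis. -/
def Attack.aliceBobDist (𝒜 : Attack (Qubits N) HE) (e : QubitBasis) :
    BitString N × BitString N → ℝ :=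
  fun x => (1 / 2 ^ N) * 𝒜.bobProb (productVector e x.1) (ketbra (productVector e x.2))

/-- Distribution of the error `A ⊕ B` when the basis `e` is used. -/
def Attack.errorDist (𝒜 : Attack (Qubits N) HE) (e : QubitBasis) : BitString N → ℝ :=
  fun l => ∑ x : BitString N × BitString N with x.1 + x.2 = l, 𝒜.aliceBobDist e x

end

end InfoDisturbance

end

namespace InfoDisturbance

open Real Finset

/-! ### Subadditivity of entropy -/

-- Let Bob measure in the barred basis `f` whichever encoding Alice used, and fix his result `B` and
-- Eve's outcome `Z`. A positive effect has the form `S† S`, so the joint weights are squared norms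
-- of vectors depending linearly on the state sent. The vectors for the `f`-encoding thus arise from
-- those for the `e`-encoding through the unitary matrix of inner products, whose entries all have
-- modulus `2^(-N/2)`. Hence `(B, Z)` has the same law in both cases, and the Maassen–Uffink
-- relation (`entropic_uncertainty`), summed over `(B, Z)`, gives `H(A|BZ,a) + H(A|BZ,b) ≥ N`.
--
-- The rest is classical (`information_le_error_entropy`): `I(A:Z|a) ≤ I(A:BZ|a) = N - H(A|BZ,a) ≤
-- H(A|BZ,b) = H(A⊕B|BZ,b) ≤ H(A⊕B|b)`. Working with unnormalized weights avoids conditioning on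
-- events of probability zero.

lemma mul_log_marginals_le {p a b R : ℝ} (hp : 0 ≤ p) (ha : p ≤ a) (hb : p ≤ b) (hR : p ≤ R) :
    p * log a + p * log b - p * log R - p * log p ≤ a * b / R - p := by
  rcases hp.eq_or_lt with rfl | hp'
  · simp only [zero_mul, sub_zero, add_zero]
    positivity
  · have ha' := hp'.trans_le ha
    have hb' := hp'.trans_le hb
    have hR' := hp'.trans_le hR
    -- The ratio of the product of the marginals to the joint weight: nonnegativity of relative
    -- entropy, term by term.
    have h := log_le_sub_one_of_pos (x := a * b / R / p) (by positivity)
    rw [log_div (by positivity) hp'.ne', log_div (by positivity) hR'.ne',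
      log_mul ha'.ne' hb'.ne'] at h
    have h2 := mul_le_mul_of_nonneg_left h hp
    have h3 : p * (a * b / R / p - 1) = a * b / R - p := by field_simp
    linarith

/-- Subadditivity of entropy for a nonnegative, not necessarily normalized, joint weight. -/
lemma sum_negMulLog_add_le {α β : Type*} [Fintype α] [Fintype β] (r : α → β → ℝ)
    (hr : ∀ a b, 0 ≤ r a b) :
    ∑ a, ∑ b, negMulLog (r a b) + negMulLog (∑ a, ∑ b, r a b) ≤
      ∑ a, negMulLog (∑ b, r a b) + ∑ b, negMulLog (∑ a, r a b) := by
  set R := ∑ a, ∑ b, r a b with hR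
  set A : α → ℝ := fun a => ∑ b, r a b with hA
  set B : β → ℝ := fun b => ∑ a, r a b with hB
  have hrA : ∀ a b, r a b ≤ A a := fun a b =>
    single_le_sum (f := fun b => r a b) (fun b _ => hr a b) (mem_univ b)
  have hrB : ∀ a b, r a b ≤ B b := fun a b =>
    single_le_sum (f := fun a => r a b) (fun a _ => hr a b) (mem_univ a)
  have hAR : ∀ a, A a ≤ R := fun a =>
    single_le_sum (f := A) (fun a _ => sum_nonneg fun b _ => hr a b) (mem_univ a)
  have key : ∑ a, ∑ b, (r a b * log (A a) + r a b * log (B b) - r a b * log R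
      - r a b * log (r a b)) ≤ ∑ a, ∑ b, (A a * B b / R - r a b) :=
    sum_le_sum fun a _ => sum_le_sum fun b _ =>
      mul_log_marginals_le (hr a b) (hrA a b) (hrB a b) ((hrA a b).trans (hAR a))
  have hBR : ∑ b, B b = R := by rw [hR, sum_comm]
  have h0 : ∑ a, ∑ b, (A a * B b / R - r a b) = 0 := by
    simp only [sum_sub_distrib, ← sum_div, ← mul_sum, ← sum_mul, hBR]
    change R * R / R - R = 0
    -- Zero total weight is included, since `0 * 0 / 0 = 0`.
    rw [mul_self_div_self, sub_self]
  have e1 : ∑ a, ∑ b, r a b * log (A a) = ∑ a, A a * log (A a) := by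
    simp only [← sum_mul, hA]
  have e2 : ∑ a, ∑ b, r a b * log (B b) = ∑ b, B b * log (B b) := by
    rw [sum_comm]; simp only [← sum_mul, hB]
  have e3 : ∑ a, ∑ b, r a b * log R = R * log R := by
    simp only [← sum_mul]
    rfl
  rw [h0] at key
  simp only [sum_sub_distrib, sum_add_distrib, e1, e2, e3] at key
  simp only [negMulLog_eq_neg, sum_neg_distrib]
  linarith

/-! ### The entropic uncertainty relation -/

/-- Right difference quotients at `0` are nonpositive. This turns an interpolation bound that is
attained at `0` into an inequality between derivatives. -/
lemma hasDerivAt_nonpos_of_nonpos_right {h : ℝ → ℝ} {h' : ℝ} (hd : HasDerivAt h h' 0)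
    (h0 : h 0 = 0) (hle : ∀ s ∈ Set.Icc (0 : ℝ) 1, h s ≤ 0) : h' ≤ 0 := by
  have ht := (hasDerivAt_iff_tendsto_slope.1 hd).mono_left
    (nhdsWithin_mono (0 : ℝ) (fun x (hx : x ∈ Set.Ioi (0 : ℝ)) => (ne_of_gt hx : x ≠ 0)))
  refine le_of_tendsto ht ?_
  filter_upwards [Ioo_mem_nhdsGT (zero_lt_one' ℝ)] with s hs
  rw [slope_def_field, h0, sub_zero, sub_zero]
  exact div_nonpos_of_nonpos_of_nonneg (hle s ⟨hs.1.le, hs.2.le⟩) hs.1.le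

section Uncertainty

variable {ι K : Type*} [Fintype ι] [NormedAddCommGroup K] [InnerProductSpace ℂ K]

open Classical in
lemma sum_norm_sq_transform (V : ι → ι → ℂ)
    (hV : ∀ x x', ∑ y, (starRingEnd ℂ) (V x y) * V x' y = if x = x' then 1 else 0)
    (a : ι → K) : ∑ y, ‖∑ x, V x y • a x‖ ^ 2 = ∑ x, ‖a x‖ ^ 2 := by
  have h : ∑ y, inner ℂ (∑ x, V x y • a x) (∑ x, V x y • a x) = ∑ x, inner ℂ (a x) (a x) := by
    simp only [sum_inner, inner_sum, inner_smul_left, inner_smul_right]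
    rw [sum_comm]
    refine sum_congr rfl fun x _ => ?_
    simp only [mul_sum]
    rw [sum_comm]
    have : ∀ x', ∑ y, V x y * ((starRingEnd ℂ) (V x' y) * inner ℂ (a x') (a x)) =
        (if x' = x then 1 else 0) * inner ℂ (a x') (a x) := by
      intro x'
      rw [← hV, sum_mul]
      exact sum_congr rfl fun y _ => by ring
    simp [this]
  have h2 := congrArg (RCLike.re (K := ℂ)) h
  simpa only [map_sum, inner_self_eq_norm_sq] using h2

/-- The phase and modulus twist `exp (z log ‖v‖) • v` of a vector. -/
noncomputable def powTwist (z : ℂ) (v : K) : K := Complex.exp (z * (Real.log ‖v‖ : ℝ)) • v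

lemma norm_powTwist (z : ℂ) (v : K) : ‖powTwist z v‖ = exp (z.re * log ‖v‖) * ‖v‖ := by
  rw [powTwist, norm_smul, Complex.norm_exp, Complex.re_mul_ofReal]

lemma norm_powTwist_of_re_eq_zero {z : ℂ} (hz : z.re = 0) (v : K) : ‖powTwist z v‖ = ‖v‖ := by
  simp [norm_powTwist, hz]

lemma norm_powTwist_of_re_eq_one {z : ℂ} (hz : z.re = 1) (v : K) :
    ‖powTwist z v‖ = ‖v‖ ^ 2 := by
  rw [norm_powTwist, hz, one_mul]
  by_cases hv : v = 0
  · simp [hv]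
  · rw [exp_log (norm_pos_iff.2 hv), sq]

/-- Entropic uncertainty relation of Maassen and Uffink, for unnormalized amplitudes with values
in a Hilbert space, and a unitary matrix `V` whose entries are at most `c` in modulus. -/
theorem entropic_uncertainty [DecidableEq ι] (V : ι → ι → ℂ) {c : ℝ} (hc : 0 < c)
    (hV : ∀ x x', ∑ y, (starRingEnd ℂ) (V x y) * V x' y = if x = x' then 1 else 0)
    (hVc : ∀ x y, ‖V x y‖ ≤ c) (a : ι → K) :
    2 * negMulLog (∑ x, ‖a x‖ ^ 2) - 2 * (∑ x, ‖a x‖ ^ 2) * log c ≤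
      ∑ x, negMulLog (‖a x‖ ^ 2) + ∑ y, negMulLog (‖∑ x, V x y • a x‖ ^ 2) := by
  set w := ∑ x, ‖a x‖ ^ 2 with hw
  set b : ι → K := fun y => ∑ x, V x y • a x with hb
  have hsum : ∀ a : ι → K, ∑ y, ‖∑ x, V x y • a x‖ ^ 2 = ∑ x, ‖a x‖ ^ 2 :=
    sum_norm_sq_transform V (by convert hV)
  have hbw : ∑ y, ‖b y‖ ^ 2 = w := hsum a
  have hw0 : 0 ≤ w := sum_nonneg fun x _ => by positivity
  rcases hw0.eq_or_lt with hw1 | hwpos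
  · have ha0 : ∀ x, a x = 0 := fun x => by
      have := (sum_eq_zero_iff_of_nonneg (fun x _ => by positivity)).1 hw1.symm x (mem_univ x)
      simpa using this
    simp [← hw1, ha0]
  -- The three lines theorem will bound `F` on the strip. The bound is attained at `0`, where `F 0 =
  -- w`, and its derivative there contains the entropies. The value `log 0 = 0` is harmless, as the
  -- corresponding inner product vanishes.
  let F : ℂ → ℂ := fun z => ∑ y, ∑ x, V x y * inner ℂ (b y) (a x) *
    Complex.exp (z * ((log ‖b y‖ + log ‖a x‖ : ℝ) : ℂ))
  have hF : ∀ z, F z = ∑ y, inner ℂ (powTwist ((starRingEnd ℂ) z) (b y))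
      (∑ x, V x y • powTwist z (a x)) := by
    intro z
    refine sum_congr rfl fun y _ => ?_
    rw [inner_sum]
    refine sum_congr rfl fun x _ => ?_
    rw [powTwist, powTwist, inner_smul_right, inner_smul_right, inner_smul_left,
      ← Complex.exp_conj, map_mul, Complex.conj_conj, Complex.conj_ofReal, Complex.ofReal_add,
      mul_add, Complex.exp_add]
    ring
  have hdiff : Differentiable ℂ F := by fun_prop
  have hbound : BddAbove ((norm ∘ F) '' Complex.HadamardThreeLines.verticalClosedStrip 0 1) := by
    refine ⟨∑ y, ∑ x, ‖V x y * inner ℂ (b y) (a x)‖ * exp |log ‖b y‖ + log ‖a x‖|, ?_⟩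
    rintro _ ⟨z, hz, rfl⟩
    refine (norm_sum_le _ _).trans (sum_le_sum fun y _ => (norm_sum_le _ _).trans
      (sum_le_sum fun x _ => ?_))
    rw [norm_mul, Complex.norm_exp, Complex.re_mul_ofReal]
    gcongr
    have hz' : 0 ≤ z.re ∧ z.re ≤ 1 := hz
    calc z.re * (log ‖b y‖ + log ‖a x‖) ≤ z.re * |log ‖b y‖ + log ‖a x‖| :=
          mul_le_mul_of_nonneg_left (le_abs_self _) hz'.1
      _ ≤ _ := mul_le_of_le_one_left (abs_nonneg _) hz'.2
  -- Here the twists are pure phases: Cauchy–Schwarz and the isometry property of `V` suffice.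
  have h0 : ∀ z ∈ Complex.re ⁻¹' {(0 : ℝ)}, ‖F z‖ ≤ w := by
    intro z hz
    have hz : z.re = 0 := hz
    rw [hF]
    calc _ ≤ ∑ y, ‖b y‖ * ‖∑ x, V x y • powTwist z (a x)‖ := by
          refine (norm_sum_le _ _).trans (sum_le_sum fun y _ => (norm_inner_le_norm _ _).trans ?_)
          rw [norm_powTwist_of_re_eq_zero (by simpa using hz)]
      _ ≤ √(∑ y, ‖b y‖ ^ 2) * √(∑ y, ‖∑ x, V x y • powTwist z (a x)‖ ^ 2) :=
          Real.sum_mul_le_sqrt_mul_sqrt _ _ _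
      _ = w := by
          rw [hbw, hsum]
          simp only [norm_powTwist_of_re_eq_zero hz, ← hw]
          exact Real.mul_self_sqrt hw0
  -- Here the twists square the norms, and the entrywise bound `c` enters.
  have h1 : ∀ z ∈ Complex.re ⁻¹' {(1 : ℝ)}, ‖F z‖ ≤ w * w * c := by
    intro z hz
    have hz : z.re = 1 := hz
    rw [hF]
    calc _ ≤ ∑ y, ‖b y‖ ^ 2 * ∑ x, c * ‖a x‖ ^ 2 := by
          refine (norm_sum_le _ _).trans (sum_le_sum fun y _ => (norm_inner_le_norm _ _).trans ?_)
          rw [norm_powTwist_of_re_eq_one (by simpa using hz)]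
          gcongr
          refine (norm_sum_le _ _).trans (sum_le_sum fun x _ => ?_)
          rw [norm_smul, norm_powTwist_of_re_eq_one hz]
          gcongr
          exact hVc x y
      _ = w * w * c := by rw [← sum_mul, ← mul_sum, hbw, ← hw]; ring
  have hline : ∀ s ∈ Set.Icc (0 : ℝ) 1, ‖F s‖ ≤ w ^ (1 - s) * (w * w * c) ^ s := by
    intro s hs
    have := Complex.HadamardThreeLines.norm_le_interp_of_mem_verticalClosedStrip₀₁' F
      (z := (s : ℂ)) (by simpa [Complex.HadamardThreeLines.verticalClosedStrip] using hs)
      hdiff.diffContOnCl hbound h0 h1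
    simpa using this
  have hG : ∀ s : ℝ, w ^ (1 - s) * (w * w * c) ^ s = w * exp (s * (log w + log c)) := by
    intro s
    rw [rpow_def_of_pos hwpos, rpow_def_of_pos (by positivity), log_mul (by positivity) hc.ne',
      log_mul hwpos.ne' hwpos.ne', ← exp_add]
    rw [show log w * (1 - s) + (log w + log w + log c) * s = log w + s * (log w + log c) by ring,
      exp_add, exp_log hwpos]
  have hF0 : F 0 = w := by
    rw [hF]
    simp only [powTwist, map_zero, zero_mul, Complex.exp_zero, one_smul]
    rw [← hbw]
    push_cast
    exact sum_congr rfl fun y _ => inner_self_eq_norm_sq_to_K (𝕜 := ℂ) (b y)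
  -- the derivative at zero
  set D : ℂ := ∑ y, ∑ x, V x y * inner ℂ (b y) (a x) * ((log ‖b y‖ + log ‖a x‖ : ℝ) : ℂ) with hD
  have hFd : HasDerivAt F D 0 := by
    refine HasDerivAt.fun_sum fun y _ => HasDerivAt.fun_sum fun x _ => ?_
    have := ((hasDerivAt_id (0 : ℂ)).mul_const ((log ‖b y‖ + log ‖a x‖ : ℝ) : ℂ)).cexp.const_mul
      (V x y * inner ℂ (b y) (a x))
    simpa using this
  have hab : ∀ x, ∑ y, V x y * inner ℂ (b y) (a x) = ((‖a x‖ ^ 2 : ℝ) : ℂ) := by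
    intro x
    simp only [hb, sum_inner, inner_smul_left, mul_sum]
    rw [sum_comm]
    have : ∀ x', ∑ y, V x y * ((starRingEnd ℂ) (V x' y) * inner ℂ (a x') (a x)) =
        (if x' = x then 1 else 0) * inner ℂ (a x') (a x) := by
      intro x'
      rw [← hV, sum_mul]
      exact sum_congr rfl fun y _ => by ring
    simp only [this, ite_mul, one_mul, zero_mul, sum_ite_eq', mem_univ, if_true]
    push_cast
    exact inner_self_eq_norm_sq_to_K (𝕜 := ℂ) (a x)
  have hbb : ∀ y, ∑ x, V x y * inner ℂ (b y) (a x) = ((‖b y‖ ^ 2 : ℝ) : ℂ) := by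
    intro y
    push_cast
    rw [← Complex.coe_algebraMap, ← inner_self_eq_norm_sq_to_K (𝕜 := ℂ) (b y)]
    conv_rhs => rw [hb]
    simp only [inner_sum, inner_smul_right]
    rfl
  have hD' : D = ((∑ y, ‖b y‖ ^ 2 * log ‖b y‖ + ∑ x, ‖a x‖ ^ 2 * log ‖a x‖ : ℝ) : ℂ) := by
    have e1 : ∑ y, ∑ x, V x y * inner ℂ (b y) (a x) * ((log ‖b y‖ : ℝ) : ℂ) =
        ∑ y, ((‖b y‖ ^ 2 : ℝ) : ℂ) * ((log ‖b y‖ : ℝ) : ℂ) :=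
      sum_congr rfl fun y _ => by rw [← sum_mul, hbb]
    have e2 : ∑ y, ∑ x, V x y * inner ℂ (b y) (a x) * ((log ‖a x‖ : ℝ) : ℂ) =
        ∑ x, ((‖a x‖ ^ 2 : ℝ) : ℂ) * ((log ‖a x‖ : ℝ) : ℂ) := by
      rw [sum_comm]
      exact sum_congr rfl fun x _ => by rw [← sum_mul, hab]
    rw [hD]
    simp only [Complex.ofReal_add, mul_add, sum_add_distrib]
    rw [e1, e2]
    push_cast
    rfl
  have hre : HasDerivAt (fun s : ℝ => (F s).re - w * exp (s * (log w + log c)))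
      (D.re - w * (log w + log c)) 0 := by
    have h1 : HasDerivAt (fun s : ℝ => (F s).re) D.re 0 :=
      HasDerivAt.real_of_complex (z := (0 : ℝ)) (by simpa using hFd)
    have h2 := (((hasDerivAt_id (0 : ℝ)).mul_const (log w + log c)).exp.const_mul w)
    exact h1.sub (by simpa using h2)
  have hfin := hasDerivAt_nonpos_of_nonpos_right hre (by simp [hF0]) (fun s hs => by
    rw [sub_nonpos, ← hG]
    exact (Complex.re_le_norm _).trans (hline s hs))
  rw [hD', Complex.ofReal_re] at hfin
  have hη : ∀ t : ℝ, negMulLog (t ^ 2) = -2 * (t ^ 2 * log t) := by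
    intro t
    rw [negMulLog, log_pow]
    push_cast
    ring
  simp only [hη, ← mul_sum]
  rw [negMulLog]
  linarith

end Uncertainty

-- Partial inner products and Born probabilities

section Tensor

variable {HB HE : Type*} [NormedAddCommGroup HB] [InnerProductSpace ℂ HB]
  [NormedAddCommGroup HE] [InnerProductSpace ℂ HE]

/-- The partial inner product `⟨v| ⊗ 1`. -/
noncomputable def partialInner (v : HB) : HB ⊗[ℂ] HE →ₗ[ℂ] HE :=
  TensorProduct.lift ((LinearMap.lsmul ℂ HE : ℂ →ₗ[ℂ] HE →ₗ[ℂ] HE).comp (innerₛₗ ℂ v))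

@[simp] lemma partialInner_tmul (v x : HB) (y : HE) :
    partialInner v (x ⊗ₜ[ℂ] y) = inner ℂ v x • y := by
  simp [partialInner]

lemma ketbra_apply (v x : HB) : ketbra v x = inner ℂ v x • v := by
  simp [ketbra]

/-- Bob's outcome `v` leaves Eve with the unnormalized vector `(⟨v| ⊗ 1) ψ`, so later arguments can
stay in `HE`. -/
lemma inner_map_ketbra (v : HB) (M : HE →ₗ[ℂ] HE) (ψ φ : HB ⊗[ℂ] HE) :
    inner ℂ ψ (TensorProduct.map (ketbra v) M φ) =
      inner ℂ (partialInner v ψ) (M (partialInner v φ)) := by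
  induction φ with
  | zero => simp
  | add φ₁ φ₂ h₁ h₂ => simp only [map_add, inner_add_right, h₁, h₂]
  | tmul x y =>
    induction ψ with
    | zero => simp
    | add ψ₁ ψ₂ h₁ h₂ => simp only [map_add, inner_add_left, h₁, h₂]
    | tmul x' y' =>
      simp only [TensorProduct.map_tmul, ketbra_apply, TensorProduct.inner_tmul,
        partialInner_tmul, map_smul, inner_smul_left, inner_smul_right, inner_conj_symm]
      ring

lemma bornProb_map_ketbra (v : HB) (M : HE →ₗ[ℂ] HE) (ψ : HB ⊗[ℂ] HE) :
    bornProb ψ (TensorProduct.map (ketbra v) M) = bornProb (partialInner v ψ) M := by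
  simp only [bornProb, inner_map_ketbra]

lemma bornProb_sum {H ι : Type*} [NormedAddCommGroup H] [InnerProductSpace ℂ H] (s : Finset ι)
    (ψ : H) (M : ι → H →ₗ[ℂ] H) : bornProb ψ (∑ i ∈ s, M i) = ∑ i ∈ s, bornProb ψ (M i) := by
  simp [bornProb, LinearMap.sum_apply]

lemma bornProb_id {H : Type*} [NormedAddCommGroup H] [InnerProductSpace ℂ H] (ψ : H) :
    bornProb ψ LinearMap.id = ‖ψ‖ ^ 2 :=
  inner_self_eq_norm_sq (𝕜 := ℂ) ψ

lemma sum_ketbra {ι : Type*} [Fintype ι] (b : OrthonormalBasis ι ℂ HB) :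
    ∑ i, ketbra (b i) = LinearMap.id := by
  ext x
  simp only [LinearMap.sum_apply, ketbra_apply, LinearMap.id_apply]
  exact b.sum_repr' x

lemma bornProb_id_map_eq_sum {ι : Type*} [Fintype ι] (b : OrthonormalBasis ι ℂ HB)
    (M : HE →ₗ[ℂ] HE) (ψ : HB ⊗[ℂ] HE) :
    bornProb ψ (TensorProduct.map LinearMap.id M) = ∑ i, bornProb (partialInner (b i) ψ) M := by
  simp only [← bornProb_map_ketbra, ← bornProb_sum]
  rw [← sum_ketbra b]
  congr 1
  ext
  simp [LinearMap.sum_apply, TensorProduct.sum_tmul]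

/-- A positive operator is of the form `S† S`. -/
lemma exists_bornProb_eq_norm_sq [FiniteDimensional ℂ HE] {M : HE →ₗ[ℂ] HE}
    (hM : M.IsPositive) :
    ∃ (m : ℕ) (S : HE →ₗ[ℂ] EuclideanSpace ℂ (Fin m)), ∀ v, bornProb v M = ‖S v‖ ^ 2 := by
  obtain ⟨m, u, hu⟩ := ContinuousLinearMap.isPositive_iff_eq_sum_rankOne.1
    ((LinearMap.isPositive_toContinuousLinearMap_iff M).2 hM)
  refine ⟨m, (WithLp.linearEquiv 2 ℂ (Fin m → ℂ)).symm.toLinearMap ∘ₗ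
    LinearMap.pi fun i => innerₛₗ ℂ (u i), fun v => ?_⟩
  have hMv : M v = ∑ i, inner ℂ (u i) v • u i := by
    have := congrArg (fun T : HE →L[ℂ] HE => T v) hu
    simpa [_root_.sum_apply] using this
  rw [EuclideanSpace.norm_sq_eq, bornProb, hMv, inner_sum, Complex.re_sum]
  refine sum_congr rfl fun i _ => ?_
  rw [inner_smul_right, ← inner_conj_symm v, Complex.mul_conj, Complex.ofReal_re,
    Complex.normSq_eq_norm_sq]
  rfl

end Tensor

-- Product bases of `N` qubits

section Qubits

variable {N : ℕ}

lemma inner_productVector (e f : QubitBasis) (i j : BitString N) :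
    inner ℂ (productVector e i) (productVector f j) = ∏ k, inner ℂ (e (i k)) (f (j k)) := by
  simp only [productVector, PiLp.inner_apply, RCLike.inner_apply, map_prod, ← prod_mul_distrib]
  exact (Fintype.prod_sum fun k s => f (j k) s * (starRingEnd ℂ) (e (i k) s)).symm

lemma orthonormal_productVector (e : QubitBasis) :
    Orthonormal ℂ (productVector e : BitString N → Qubits N) := by
  rw [orthonormal_iff_ite]
  intro i j
  rw [inner_productVector]
  simp only [orthonormal_iff_ite.1 e.orthonormal]
  rw [prod_ite_zero]
  simp [funext_iff]

/-- The product basis of `N` qubits. -/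
noncomputable def productBasis (e : QubitBasis) : OrthonormalBasis (BitString N) ℂ (Qubits N) :=
  (basisOfOrthonormalOfCardEqFinrank (orthonormal_productVector e) (by simp)).toOrthonormalBasis
    (by simpa using orthonormal_productVector e)

@[simp] lemma productBasis_apply (e : QubitBasis) (i : BitString N) :
    productBasis e i = productVector e i := by
  simp [productBasis]

lemma norm_inner_productVector {e f : QubitBasis} (h : MutuallyUnbiased e f)
    (i j : BitString N) :
    ‖inner ℂ (productVector e i) (productVector f j)‖ = √(1 / 2) ^ N := by
  have : ∀ a b, ‖inner ℂ (e a) (f b)‖ = √(1 / 2) := fun a b => by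
    rw [← h a b, Real.sqrt_sq (norm_nonneg _)]
  simp [inner_productVector, this]

end Qubits

-- From the uncertainty relation to the information bound, classically

lemma shannonEntropy_eq {α : Type*} [Fintype α] (p : α → ℝ) :
    shannonEntropy p = (∑ x, negMulLog (p x)) / log 2 := by
  rw [shannonEntropy, sum_div, ← sum_neg_distrib]
  refine sum_congr rfl fun x _ => ?_
  rw [negMulLog, logb]
  ring

/-- If the joint weights `P` of `(X, B, Z)` and `Q` of `(Y, B, Z)` have the same marginal on
`(B, Z)` and satisfy an uncertainty relation with bound `L` for each value of `(B, Z)`, then the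
mutual information of `X` and `Z` is at most the entropy of `Y - B`, provided `H(X) ≤ L`. -/
lemma information_le_error_entropy {G γ : Type*} [Fintype G] [AddCommGroup G] [Fintype γ]
    (P Q : G → G → γ → ℝ) {L : ℝ} (hP : ∀ x b z, 0 ≤ P x b z) (hQ : ∀ y b z, 0 ≤ Q y b z)
    (hPQ : ∀ b z, ∑ y, Q y b z = ∑ x, P x b z) (hP1 : ∑ x, ∑ b, ∑ z, P x b z = 1)
    (hX : ∑ x, negMulLog (∑ b, ∑ z, P x b z) ≤ L)
    (hU : ∀ b z, 2 * negMulLog (∑ x, P x b z) + (∑ x, P x b z) * L ≤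
      ∑ x, negMulLog (P x b z) + ∑ y, negMulLog (Q y b z)) :
    ∑ x, negMulLog (∑ b, ∑ z, P x b z) + ∑ z, negMulLog (∑ x, ∑ b, P x b z)
      - ∑ x, ∑ z, negMulLog (∑ b, P x b z) ≤
      ∑ l, negMulLog (∑ b, ∑ z, Q (l + b) b z) := by
  set w : G → γ → ℝ := fun b z => ∑ x, P x b z with hw
  have hw1 : ∑ b, ∑ z, w b z = 1 := by
    rw [← hP1, sum_comm (s := univ (α := G)) (t := univ (α := G))]
    exact sum_congr rfl fun b _ => sum_comm
  -- Subadditivity for `(X, B)` at each `z`, that is `I(X:Z) ≤ I(X:BZ)`.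
  have h1 : ∑ z, (∑ x, ∑ b, negMulLog (P x b z) + negMulLog (∑ x, ∑ b, P x b z)) ≤
      ∑ z, (∑ x, negMulLog (∑ b, P x b z) + ∑ b, negMulLog (w b z)) :=
    sum_le_sum fun z _ => sum_negMulLog_add_le (fun x b => P x b z) fun x b => hP x b z
  have h2 : ∑ b, ∑ z, (2 * negMulLog (w b z) + w b z * L) ≤
      ∑ b, ∑ z, (∑ x, negMulLog (P x b z) + ∑ y, negMulLog (Q y b z)) :=
    sum_le_sum fun b _ => sum_le_sum fun z _ => hU b z
  -- Once `B` is known, `Y` and `Y - B` determine each other.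
  have hshift : ∀ (φ : ℝ → ℝ) b z, ∑ l, φ (Q (l + b) b z) = ∑ y, φ (Q y b z) :=
    fun φ b z => Equiv.sum_comp (Equiv.addRight b) fun y => φ (Q y b z)
  -- Discarding `(B, Z)`: `H(Y-B|BZ) ≤ H(Y-B)`.
  have h3 := sum_negMulLog_add_le (fun (l : G) (c : G × γ) => Q (l + c.1) c.1 c.2)
    fun l c => hQ _ _ _
  have hQ1 : ∑ l, ∑ b, ∑ z, Q (l + b) b z = 1 := by
    rw [← hw1, sum_comm (s := univ (α := G))]
    refine sum_congr rfl fun b _ => ?_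
    rw [sum_comm]
    refine sum_congr rfl fun z _ => ?_
    rw [hshift (fun t => t), hPQ]
  have hQη : ∑ l, ∑ b, ∑ z, negMulLog (Q (l + b) b z) = ∑ b, ∑ z, ∑ y, negMulLog (Q y b z) := by
    rw [sum_comm (s := univ (α := G))]
    refine sum_congr rfl fun b _ => ?_
    rw [sum_comm]
    exact sum_congr rfl fun z _ => hshift _ b z
  have hPη : ∑ z, ∑ x, ∑ b, negMulLog (P x b z) = ∑ b, ∑ z, ∑ x, negMulLog (P x b z) := by
    rw [sum_comm (s := univ (α := G))]
    refine sum_congr rfl fun z _ => sum_comm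
  have hc1 : ∑ z, ∑ x, negMulLog (∑ b, P x b z) = ∑ x, ∑ z, negMulLog (∑ b, P x b z) := sum_comm
  have hc2 : ∑ z, ∑ b, negMulLog (w b z) = ∑ b, ∑ z, negMulLog (w b z) := sum_comm
  simp only [Fintype.sum_prod_type, hQ1, negMulLog_one, hQη, hshift (fun t => t), hPQ] at h3
  simp only [sum_add_distrib, ← mul_sum, ← sum_mul, hw1, hPη, hc1, hc2] at h1 h2
  change _ ≤ _ + ∑ b, ∑ z, negMulLog (w b z) at h3
  linarith

lemma bornProb_nonneg {H : Type*} [NormedAddCommGroup H] [InnerProductSpace ℂ H]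
    {M : H →ₗ[ℂ] H} (hM : M.IsPositive) (ψ : H) : 0 ≤ bornProb ψ M :=
  hM.re_inner_nonneg_right ψ

-- Joint weights of an attack and the final bound

section Attack

variable {N : ℕ} {HE : Type*} [NormedAddCommGroup HE] [InnerProductSpace ℂ HE]

lemma Attack.finalState_sum {HB ι : Type*} [NormedAddCommGroup HB] [InnerProductSpace ℂ HB]
    [Fintype ι] (𝒜 : Attack HB HE) (c : ι → ℂ) (v : ι → HB) :
    𝒜.finalState (∑ i, c i • v i) = ∑ i, c i • 𝒜.finalState (v i) := by
  simp [Attack.finalState, TensorProduct.sum_tmul, map_sum, ← TensorProduct.smul_tmul']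

lemma Attack.norm_finalState {HB : Type*} [NormedAddCommGroup HB] [InnerProductSpace ℂ HB]
    (𝒜 : Attack HB HE) (v : HB) : ‖𝒜.finalState v‖ = ‖v‖ := by
  simp [Attack.finalState, 𝒜.norm_Ω]

/-- Joint weight of Alice's uniformly random string `x`, encoded in the basis `g`, of the string
`b` obtained by Bob in the basis `f`, and of an effect `M` of Eve. -/
noncomputable def Attack.jointWeight (𝒜 : Attack (Qubits N) HE) (g f : QubitBasis)
    (M : HE →ₗ[ℂ] HE) (x b : BitString N) : ℝ :=
  (1 / 2 ^ N) * bornProb (partialInner (productVector f b) (𝒜.finalState (productVector g x))) M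

lemma Attack.jointWeight_nonneg (𝒜 : Attack (Qubits N) HE) (g f : QubitBasis)
    {M : HE →ₗ[ℂ] HE} (hM : M.IsPositive) (x b : BitString N) : 0 ≤ 𝒜.jointWeight g f M x b :=
  mul_nonneg (by positivity) (bornProb_nonneg hM _)

lemma Attack.sum_jointWeight (𝒜 : Attack (Qubits N) HE) (g f : QubitBasis)
    (M : HE →ₗ[ℂ] HE) (x : BitString N) :
    ∑ b, 𝒜.jointWeight g f M x b = (1 / 2 ^ N) * 𝒜.eveProb (productVector g x) M := by
  rw [Attack.eveProb, bornProb_id_map_eq_sum (productBasis f), mul_sum]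
  simp [Attack.jointWeight]

lemma Attack.sum_effect_jointWeight {α : Type*} [Fintype α] (𝒜 : Attack (Qubits N) HE)
    (g f : QubitBasis) (Z : POVM HE α) (x b : BitString N) :
    ∑ z, 𝒜.jointWeight g f (Z.effect z) x b =
      (1 / 2 ^ N) * 𝒜.bobProb (productVector g x) (ketbra (productVector f b)) := by
  simp only [Attack.jointWeight, ← mul_sum, ← bornProb_sum, Z.sum_effect, Attack.bobProb,
    bornProb_map_ketbra]

lemma Attack.sum_sum_effect_jointWeight {α : Type*} [Fintype α] (𝒜 : Attack (Qubits N) HE)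
    (g f : QubitBasis) (Z : POVM HE α) (x : BitString N) :
    ∑ b, ∑ z, 𝒜.jointWeight g f (Z.effect z) x b = 1 / 2 ^ N := by
  rw [sum_comm]
  simp only [Attack.sum_jointWeight, ← mul_sum]
  simp only [Attack.eveProb, bornProb_id_map_eq_sum (productBasis f)]
  rw [sum_comm]
  simp only [← bornProb_sum, Z.sum_effect]
  rw [← bornProb_id_map_eq_sum (productBasis f), TensorProduct.map_id, bornProb_id,
    Attack.norm_finalState, (orthonormal_productVector g).norm_eq_one]
  simp

/-- The amplitudes for the two encodings of Alice are related by the unitary matrix of inner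
products between the two product bases. -/
lemma Attack.exists_amplitudes [FiniteDimensional ℂ HE] (𝒜 : Attack (Qubits N) HE)
    (e f : QubitBasis) {M : HE →ₗ[ℂ] HE} (hM : M.IsPositive) (b : BitString N) :
    ∃ (m : ℕ) (a : BitString N → EuclideanSpace ℂ (Fin m)),
      (∀ x, 𝒜.jointWeight e f M x b = ‖a x‖ ^ 2) ∧
      ∀ y, 𝒜.jointWeight f f M y b =
        ‖∑ x, inner ℂ (productVector e x) (productVector f y) • a x‖ ^ 2 := by
  obtain ⟨m, S, hS⟩ := exists_bornProb_eq_norm_sq hM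
  -- The scalar absorbs the uniform probability `1 / 2 ^ N` of Alice's string.
  set T : Qubits N ⊗[ℂ] HE →ₗ[ℂ] EuclideanSpace ℂ (Fin m) :=
    ((√(1 / 2 ^ N) : ℝ) : ℂ) • (S ∘ₗ partialInner (productVector f b)) with hT
  have key : ∀ ψ, (1 / 2 ^ N) * bornProb (partialInner (productVector f b) ψ) M = ‖T ψ‖ ^ 2 := by
    intro ψ
    rw [hS, hT, LinearMap.smul_apply, norm_smul, mul_pow, Complex.norm_real, norm_eq_abs, sq_abs,
      sq_sqrt (by positivity)]
    rfl
  refine ⟨m, fun x => T (𝒜.finalState (productVector e x)), fun x => key _, fun y => ?_⟩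
  rw [Attack.jointWeight, key]
  conv_lhs => rw [← (productBasis e).sum_repr' (productVector f y)]
  rw [Attack.finalState_sum]
  simp

lemma sum_conj_inner_mul_inner_productVector (e f : QubitBasis) (x x' : BitString N) :
    ∑ y, (starRingEnd ℂ) (inner ℂ (productVector e x) (productVector f y)) *
      inner ℂ (productVector e x') (productVector f y) = if x = x' then 1 else 0 := by
  have := (productBasis f).sum_inner_mul_inner (productVector e x') (productVector e x)
  rw [orthonormal_iff_ite.1 (orthonormal_productVector e)] at this
  simp only [productBasis_apply] at this
  simp only [inner_conj_symm, eq_comm (a := x), ← this]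
  exact sum_congr rfl fun y _ => mul_comm _ _

lemma log_sqrt_half_pow (N : ℕ) : log (√(1 / 2) ^ N) = -(N * log 2) / 2 := by
  rw [log_pow, log_sqrt (by norm_num), one_div, log_inv]
  ring

/-- Both encodings have the same average state; in terms of amplitudes, a unitary matrix preserves
the sum of squared norms. -/
lemma Attack.jointWeight_marginal_eq [FiniteDimensional ℂ HE] (𝒜 : Attack (Qubits N) HE)
    (e f : QubitBasis) {M : HE →ₗ[ℂ] HE} (hM : M.IsPositive) (b : BitString N) :
    ∑ y, 𝒜.jointWeight f f M y b = ∑ x, 𝒜.jointWeight e f M x b := by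
  obtain ⟨m, a, ha, hb⟩ := 𝒜.exists_amplitudes e f hM b
  simp only [ha, hb]
  refine sum_norm_sq_transform _ (fun x x' => ?_) a
  convert sum_conj_inner_mul_inner_productVector e f x x'

lemma Attack.jointWeight_uncertainty [FiniteDimensional ℂ HE] (𝒜 : Attack (Qubits N) HE)
    {e f : QubitBasis} (hef : MutuallyUnbiased e f) {M : HE →ₗ[ℂ] HE} (hM : M.IsPositive)
    (b : BitString N) :
    2 * negMulLog (∑ x, 𝒜.jointWeight e f M x b) +
        (∑ x, 𝒜.jointWeight e f M x b) * (N * log 2) ≤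
      ∑ x, negMulLog (𝒜.jointWeight e f M x b) + ∑ y, negMulLog (𝒜.jointWeight f f M y b) := by
  obtain ⟨m, a, ha, hb⟩ := 𝒜.exists_amplitudes e f hM b
  simp only [ha, hb]
  have := entropic_uncertainty
    (fun x y : BitString N => inner ℂ (productVector e x) (productVector f y))
    (c := √(1 / 2) ^ N) (by positivity) (sum_conj_inner_mul_inner_productVector e f)
    (fun x y => (norm_inner_productVector hef x y).le) a
  rw [log_sqrt_half_pow] at this
  linarith

theorem Attack.mutualInfo_le [FiniteDimensional ℂ HE] (𝒜 : Attack (Qubits N) HE)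
    {e f : QubitBasis} (hef : MutuallyUnbiased e f) {α : Type*} [Fintype α] (Z : POVM HE α) :
    mutualInfo (𝒜.aliceEveDist e Z) ≤ shannonEntropy (𝒜.errorDist f) := by
  have hX := fun x => 𝒜.sum_sum_effect_jointWeight e f Z x
  have hcard : (Fintype.card (BitString N) : ℝ) = 2 ^ N := by simp [ZMod.card]
  have key := information_le_error_entropy (L := N * log 2)
    (fun x b z => 𝒜.jointWeight e f (Z.effect z) x b)
    (fun y b z => 𝒜.jointWeight f f (Z.effect z) y b)
    (fun x b z => 𝒜.jointWeight_nonneg e f (Z.effect_pos z) x b)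
    (fun x b z => 𝒜.jointWeight_nonneg f f (Z.effect_pos z) x b)
    (fun b z => 𝒜.jointWeight_marginal_eq e f (Z.effect_pos z) b)
    (by simp [hX, hcard, -Fintype.card_pi])
    (by
      simp only [hX, sum_const, card_univ, nsmul_eq_mul, hcard]
      rw [negMulLog, one_div, log_inv, log_pow]
      field_simp
      simp)
    (fun b z => 𝒜.jointWeight_uncertainty hef (Z.effect_pos z) b)
  have hAE : ∀ x z, 𝒜.aliceEveDist e Z (x, z) = ∑ b, 𝒜.jointWeight e f (Z.effect z) x b :=
    fun x z => (𝒜.sum_jointWeight e f _ x).symm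
  have herr : ∀ l, 𝒜.errorDist f l = ∑ b, ∑ z, 𝒜.jointWeight f f (Z.effect z) (l + b) b := by
    intro l
    simp only [Attack.sum_effect_jointWeight]
    symm
    -- In characteristic two the difference `Y - B` is the error `A ⊕ B`.
    have hadd : ∀ b : BitString N, b + b = 0 := fun b => funext fun k =>
      CharTwo.add_self_eq_zero (b k)
    refine sum_bij' (fun b _ => (l + b, b)) (fun x _ => x.2) (fun b _ => ?_)
      (fun _ _ => mem_univ _) (fun _ _ => rfl) (fun x hx => ?_) (fun _ _ => rfl)
    · simp [add_assoc, hadd]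
    · rw [← (mem_filter.1 hx).2, add_assoc, hadd, add_zero]
  simp only [mutualInfo, shannonEntropy_eq, ← add_div, ← sub_div]
  refine div_le_div_of_nonneg_right ?_ (log_nonneg one_le_two)
  simp only [herr, Fintype.sum_prod_type, hAE]
  have hA : ∀ x, ∑ z, ∑ b, 𝒜.jointWeight e f (Z.effect z) x b =
      ∑ b, ∑ z, 𝒜.jointWeight e f (Z.effect z) x b := fun _ => sum_comm
  simp only [hA]
  exact key

end Attack

end InfoDisturbance

theorem theorem3 (N : ℕ)
    (e f : InfoDisturbance.QubitBasis) (hef : InfoDisturbance.MutuallyUnbiased e f)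
    {HE : Type*} [NormedAddCommGroup HE] [InnerProductSpace ℂ HE] [FiniteDimensional ℂ HE]
    (𝒜 : InfoDisturbance.Attack (InfoDisturbance.Qubits N) HE) :
    𝒜.eveInfo e ≤ ((InfoDisturbance.shannonEntropy (𝒜.errorDist f) : ℝ) : EReal) :=
  iSup₂_le fun _ Z => EReal.coe_le_coe_iff.2 (𝒜.mutualInfo_le hef Z)
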